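/- In the $t$-party Exam Disjointness problem over a finite universe $U$, player $i\in\{1,\dots,t\}$ holds a set $S_i\subseteq U$ and a referee holds an element $x\in U$. It is promised that either $S_1,\dots,S_t$ are pairwise disjoint, or there is an element $y$ that belongs to all of them and no other element belongs to two of them. The referee has to decide whether $x$ is the unique common element of $S_1,\dots,S_t$. A one-way protocol (with private randomness) for this problem works as follows. In the order $i=1,\dots,t$, player $i$ sends a message, a finite bit string, to the next player, the last player sending it to the referee; the message is drawn from a distribution that depends only on $i$, on $S_i$ and on the message received from player $i-1$ (if $i>1$). The referee outputs yes or no, drawn from a distribution that depends only on $x$ and on the message of player $t$. The transcript $\Pi$ is the tuple of the messages of all $t$ players. No bound is placed on the length of the messages or on the computing power of the parties. **Theorem.** There is an absolute constant $c>0$ such that the following holds. Let $t\ge 2$ and $m\ge 2$ be integers with $t<\frac{m}{4\ln m}$, and let $U$ be a finite set with $|U|\ge m^4$. Let $\mathcal P$ be a one-way protocol with $t$ players which, on every input $(S_1,\dots,S_t,x)$ that satisfies the promise and has $|S_i|\le\lceil m/t\rceil$ for all $i$, gives the correct answer with probability at least $2/3$. Let $X'=(S_1,\dots,S_t)$, where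 $S_1,\dots,S_t$ are independent uniformly random subsets of $U$ of size $\lceil m/t\rceil$, and let $\Pi$ be the transcript of $\mathcal P$ on $X'$. Then the mutual information, in bits, satisfies $$I(X';\Pi)\;\ge\; c\cdot\frac{m}{t}.$$ -/

import Mathlib

open scoped ENNReal

namespace ExamDisjointness

noncomputable section

/-- The mutual information `I(X; Y)`, in bits, of a pair `(X, Y)` of discrete random variables with
joint law `p`: the Kullback-Leibler divergence of the joint law from the product of its marginals
(all sets measurable), divided by `ln 2`. -/
def mutualInfo {α β : Type*} [Countable α] [Countable β] (p : PMF (α × β)) : ℝ≥0∞ :=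
  letI : MeasurableSpace α := ⊤
  letI : MeasurableSpace β := ⊤
  InformationTheory.klDiv p.toMeasure
      ((p.map Prod.fst).toMeasure.prod (p.map Prod.snd).toMeasure) /
    ENNReal.ofReal (Real.log 2)

/-- A one-way private-coin protocol with `t` players, each holding a subset of `U`, and a referee
holding an element of `U`. A message is a finite bit string. Player `i`, given the message received
from the previous player (the empty string for the first player) and its own set, draws its
message with fresh private coins. The referee, given the message of the last player and its own
element, draws its verdict. -/
structure OneWayProtocol (t : ℕ) (U : Type*) where
  player : Fin t → List Bool → Finset U → PMF (List Bool)
  referee : List Bool → U → PMF Bool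

/-- The law of a chain of `n` messages: message `0` is drawn from `f 0 prev`, and each later
message `i + 1` is drawn from `f (i + 1)` applied to message `i`. -/
def chainLaw : (n : ℕ) → (Fin n → List Bool → PMF (List Bool)) → List Bool →
    PMF (Fin n → List Bool)
  | 0, _, _ => PMF.pure Fin.elim0
  | n + 1, f, prev =>
      (f 0 prev).bind fun a => (chainLaw n (fun i => f i.succ) a).map (Fin.cons a)

/-- The last of a list of `n` messages (the empty string if there is none). -/
def lastMessage {n : ℕ} (w : Fin n → List Bool) : List Bool :=
  if h : 0 < n then w ⟨n - 1, Nat.sub_lt h Nat.one_pos⟩ else []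

namespace OneWayProtocol

variable {t : ℕ} {U : Type*}

/-- The law of the transcript (the messages of all `t` players) on input sets `S`. -/
def transcript (P : OneWayProtocol t U) (S : Fin t → Finset U) : PMF (Fin t → List Bool) :=
  chainLaw t (fun i prev => P.player i prev (S i)) []

/-- The law of the referee's verdict on input sets `S` and question `x`. -/
def verdict (P : OneWayProtocol t U) (S : Fin t → Finset U) (x : U) : PMF Bool :=
  (P.transcript S).bind fun w => P.referee (lastMessage w) x

/-- The joint law of the input sets, drawn from `μ`, and the transcript. -/
def jointLaw (P : OneWayProtocol t U) (μ : PMF (Fin t → Finset U)) :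
    PMF ((Fin t → Finset U) × (Fin t → List Bool)) :=
  μ.bind fun S => (P.transcript S).map fun w => (S, w)

end OneWayProtocol

/-- The promise: either the sets are pairwise disjoint, or some element belongs to all of them and
no other element belongs to two of them. -/
def Promise {t : ℕ} {U : Type*} (S : Fin t → Finset U) : Prop :=
  (∀ i j, i ≠ j → Disjoint (S i) (S j)) ∨
    ∃ y, (∀ i, y ∈ S i) ∧ ∀ i j, i ≠ j → ∀ z, z ∈ S i → z ∈ S j → z = y

/-- The correct answer is "yes": `x` is the unique common element of all the sets. -/
def IsUniqueCommon {t : ℕ} {U : Type*} (S : Fin t → Finset U) (x : U) : Prop :=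
  ∀ y, (∀ i, y ∈ S i) ↔ y = x

/-- `P` solves Exam Disjointness with success probability at least `2 / 3` on every input that
satisfies the promise and whose sets have at most `k` elements. -/
def OneWayProtocol.SolvesEDISJ {t : ℕ} {U : Type*} (P : OneWayProtocol t U) (k : ℕ) : Prop :=
  ∀ (S : Fin t → Finset U) (x : U), Promise S → (∀ i, (S i).card ≤ k) →
    (IsUniqueCommon S x → 2 / 3 ≤ P.verdict S x true) ∧
    (¬ IsUniqueCommon S x → 2 / 3 ≤ P.verdict S x false)

/-- The size `⌈m / t⌉` of the input sets. -/
def setSize (m t : ℕ) : ℕ := ⌈(m : ℝ) / t⌉₊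

theorem setSize_le_card {m : ℕ} (t : ℕ) {U : Type*} [Fintype U] (hU : m ^ 4 ≤ Fintype.card U) :
    setSize m t ≤ Fintype.card U := by
  refine le_trans (Nat.ceil_le.mpr ?_) (le_trans (Nat.le_self_pow (by norm_num) m) hU)
  rcases Nat.eq_zero_or_pos t with rfl | ht
  · simp
  · exact div_le_self (Nat.cast_nonneg m) (by exact_mod_cast ht)

theorem piFinset_powersetCard_nonempty (t : ℕ) {k : ℕ} {U : Type*} [Fintype U]
    (hk : k ≤ Fintype.card U) :
    (Fintype.piFinset fun _ : Fin t => (Finset.univ : Finset U).powersetCard k).Nonempty :=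
  Fintype.piFinset_nonempty.mpr fun _ => Finset.powersetCard_nonempty.mpr hk

/-- The law of `t` independent uniformly random `k`-element subsets of `U`, that is, the uniform
law on the `t`-tuples of `k`-element subsets. -/
def inputLaw (t : ℕ) {k : ℕ} {U : Type*} [Fintype U] (hk : k ≤ Fintype.card U) :
    PMF (Fin t → Finset U) :=
  PMF.uniformOfFinset
    (Fintype.piFinset fun _ : Fin t => (Finset.univ : Finset U).powersetCard k)
    (piFinset_powersetCard_nonempty t hk)

end

end ExamDisjointness

/-!
A protocol that answers correctly must behave differently on random sets and on random sets into
which a common element `x` has been planted. For a set `A` of players let `π_A` be the law of the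
transcript when the players in `A` hold `x` and all inputs are otherwise uniformly random
(`plantedLaw`). Correctness makes `π_∅` and `π_univ` far apart in Hellinger distance
(`le_hellingerSq_of_solves`), because random sets rarely meet outside the planted point.

Since the inputs are independent and the protocol is one-way, `π_A (w)` is a product over the
players, which gives the cut-and-paste identity `π_A π_B = π_∅ π_{A ∪ B}` for disjoint `A`, `B`
(`plantedLaw_mul_plantedLaw`). So the squared Hellinger distance of `π_A` and `π_B` equals that of
`π_∅` and `π_{A ∪ B}`. In Euclidean geometry, `∑_{i<j} ‖u_i - u_j‖² ≤ n ∑_i ‖u_i - u_0‖²`;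
applied to the roots of the densities, this says that among `n` blocks of players some pair can be
merged while the sum of the squared distances to `π_∅` grows by a factor of at most
`1 + 2 / (n (n - 1))`. The product of these factors converges, and so a constant fraction of the
squared distance of `π_univ` from `π_∅` is already present in the sum over single players
(`hellingerSq_univ_le`). There is no loss that depends on `t`.

The mutual information is bounded below by the variational formula with a test function that adds up
one score for each element `x` held by each player `i`, namely the logarithm of
`(1 + √(π_{i} / π_∅)) / 2` (`logTilt`). Its mean is `k / |U|` times the sum, over `x` and `i`, of
quantities that dominate the squared Hellinger distance of `π_{i}` and `π_∅`
(`hellingerSq_div_four_le_tsum_logTilt`, `sum_tsum_score`). Its exponential moment under the product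
of the marginals is at most `1 + O(k² t / |U|)`: for fixed transcript the `k` elements of a random
set would be independent if drawn with replacement, each contributing a mean of at most `1`
(`sum_inputLaw_exp_le`). Together these give an information of order `k ≥ m / t`
(`sum_hellingerSq_le_mutualInfo`), the error being negligible as `|U| ≥ m⁴`.
-/

namespace ExamDisjointness

open Finset MeasureTheory

/-! ### Squared Hellinger distances -/

/-- The (unnormalised) squared Hellinger distance `∑ (√p - √q)²` of two discrete densities. -/
noncomputable def hellingerSq {W : Type*} (p q : W → ℝ) : ℝ :=
  ∑' w, (√(p w) - √(q w)) ^ 2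

section Hellinger

variable {W : Type*} {p q : W → ℝ}

theorem summable_hellingerSq (hp : ∀ w, 0 ≤ p w) (hq : ∀ w, 0 ≤ q w) (hps : Summable p)
    (hqs : Summable q) : Summable fun w => (√(p w) - √(q w)) ^ 2 := by
  refine Summable.of_nonneg_of_le (fun w => sq_nonneg _) (fun w => ?_) (hps.add hqs)
  nlinarith [Real.sq_sqrt (hp w), Real.sq_sqrt (hq w), Real.sqrt_nonneg (p w),
    Real.sqrt_nonneg (q w), mul_nonneg (Real.sqrt_nonneg (p w)) (Real.sqrt_nonneg (q w))]

theorem hellingerSq_nonneg : 0 ≤ hellingerSq p q := tsum_nonneg fun _ => sq_nonneg _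

theorem hellingerSq_comm : hellingerSq p q = hellingerSq q p :=
  tsum_congr fun _ => by ring

theorem hellingerSq_self : hellingerSq p p = 0 := by simp [hellingerSq]

/-- The squared Hellinger distance of two probability densities depends only on their pointwise
product. -/
theorem hellingerSq_eq_of_mul_eq {p' q' : W → ℝ} (hp : ∀ w, 0 ≤ p w) (hq : ∀ w, 0 ≤ q w)
    (hp' : ∀ w, 0 ≤ p' w) (hq' : ∀ w, 0 ≤ q' w) (hps : HasSum p 1) (hqs : HasSum q 1)
    (hps' : HasSum p' 1) (hqs' : HasSum q' 1) (h : ∀ w, p w * q w = p' w * q' w) :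
    hellingerSq p q = hellingerSq p' q' := by
  have h1 := (summable_hellingerSq hp hq hps.summable hqs.summable).hasSum
  have h2 := (summable_hellingerSq hp' hq' hps'.summable hqs'.summable).hasSum
  have h3 := ((h2.add (hps.add hqs)).sub (hps'.add hqs'))
  have h4 : (fun w => (√(p' w) - √(q' w)) ^ 2 + (p w + q w) - (p' w + q' w))
      = fun w => (√(p w) - √(q w)) ^ 2 := by
    funext w
    have e : √(p w) * √(q w) = √(p' w) * √(q' w) := by
      rw [← Real.sqrt_mul (hp w), ← Real.sqrt_mul (hp' w), h]
    nlinarith [Real.sq_sqrt (hp w), Real.sq_sqrt (hq w), Real.sq_sqrt (hp' w),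
      Real.sq_sqrt (hq' w)]
  rw [h4] at h3
  have := h1.unique h3
  simp only [hellingerSq]
  linarith

/-- A test with values in `[0, 1]` that tells `p` from `q` with advantage `δ` forces the squared
Hellinger distance to be at least `δ² / 4`. -/
theorem sq_div_four_le_hellingerSq (hp : ∀ w, 0 ≤ p w) (hq : ∀ w, 0 ≤ q w) (hps : HasSum p 1)
    (hqs : HasSum q 1) {r : W → ℝ} (hr0 : ∀ w, 0 ≤ r w) (hr1 : ∀ w, r w ≤ 1) {a b δ : ℝ}
    (ha : HasSum (fun w => p w * r w) a) (hb : HasSum (fun w => q w * r w) b) (hδ : 0 < δ)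
    (hab : δ ≤ a - b) : δ ^ 2 / 4 ≤ hellingerSq p q := by
  have h1 := (summable_hellingerSq hp hq hps.summable hqs.summable).hasSum
  have h2 := (h1.mul_left (2 / δ)).add ((hps.add hqs).mul_left (δ / 4))
  have h3 : a - b ≤ 2 / δ * hellingerSq p q + δ / 4 * (1 + 1) := by
    refine hasSum_le (fun w => ?_) (ha.sub hb) h2
    set u := √(p w)
    set v := √(q w)
    have hu : p w = u ^ 2 := (Real.sq_sqrt (hp w)).symm
    have hv : q w = v ^ 2 := (Real.sq_sqrt (hq w)).symm
    have e1 : p w * r w - q w * r w ≤ |u ^ 2 - v ^ 2| := by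
      rw [← sub_mul, hu, hv]
      refine (le_abs_self _).trans ?_
      rw [abs_mul, abs_of_nonneg (hr0 w)]
      exact mul_le_of_le_one_right (abs_nonneg _) (hr1 w)
    have e2 : ∀ s : ℝ, s ^ 2 = 1 →
        s * (u ^ 2 - v ^ 2) ≤ 2 / δ * (u - v) ^ 2 + δ / 4 * (u ^ 2 + v ^ 2) := by
      intro s hs
      have e3 : 2 / δ * (u - v) ^ 2 + δ / 4 * (u ^ 2 + v ^ 2) - s * (u ^ 2 - v ^ 2)
          = (1 / (8 * δ)) * (4 * (u - v) - s * δ * (u + v)) ^ 2 + δ / 8 * (u - v) ^ 2 := by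
        field_simp
        linear_combination (-4 * (δ ^ 2 * (u + v) ^ 2)) * hs
      have : 0 ≤ (1 / (8 * δ)) * (4 * (u - v) - s * δ * (u + v)) ^ 2 + δ / 8 * (u - v) ^ 2 := by
        positivity
      linarith
    rw [hu, hv] at *
    refine e1.trans (abs_le'.mpr ⟨?_, ?_⟩)
    · have := e2 1 (by norm_num); linarith
    · have := e2 (-1) (by norm_num); linarith
  have h4 : δ / 2 ≤ 2 / δ * hellingerSq p q := by linarith
  have h5 : δ / 2 * (δ / 2) ≤ 2 / δ * hellingerSq p q * (δ / 2) :=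
    mul_le_mul_of_nonneg_right h4 (by positivity)
  have h6 : 2 / δ * hellingerSq p q * (δ / 2) = hellingerSq p q := by field_simp
  nlinarith

/-- The logarithm of a half-and-half mixture of `1` and the root of a density ratio. Unlike the
logarithm of the ratio itself it is bounded below, and its mean under `p` still dominates the
squared Hellinger distance. -/
noncomputable def logTilt (p q : ℝ) : ℝ := Real.log ((1 + √(p / q)) / 2)

theorem half_le_tilt (a b : ℝ) : (1 : ℝ) / 2 ≤ (1 + √(a / b)) / 2 := by
  have := Real.sqrt_nonneg (a / b); linarith

theorem abs_logTilt_le {a b C : ℝ} (hC : 1 ≤ C) (h : a / b ≤ C) :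
    |logTilt a b| ≤ Real.log 2 + C := by
  have h0 := half_le_tilt a b
  have hlog2 := Real.log_pos (by norm_num : (1 : ℝ) < 2)
  have hs : √(a / b) ≤ C := by
    refine (Real.sqrt_le_sqrt h).trans ?_
    rw [Real.sqrt_le_left (by linarith)]
    nlinarith
  refine abs_le.mpr ⟨?_, ?_⟩
  · have := Real.log_le_log (by norm_num) h0
    rw [Real.log_div one_ne_zero two_ne_zero, Real.log_one] at this
    unfold logTilt
    linarith
  · have := Real.log_le_sub_one_of_pos (lt_of_lt_of_le (by norm_num) h0)
    unfold logTilt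
    linarith

/-- With `u = √a` and `v = √b` the bound `1 - y⁻¹ ≤ log y` gives `(u - v) / (u + v) ≤ logTilt a b`.
The term `(a - b) / 4` removes the first-order part and sums to zero over two probability
densities. -/
theorem mul_logTilt_ge {a b : ℝ} (ha : 0 ≤ a) (hb : 0 ≤ b) (hab : b = 0 → a = 0) :
    (√a - √b) ^ 2 / 4 + (a - b) / 4 ≤ a * logTilt a b := by
  rcases hb.eq_or_lt with h | h
  · simp [← h, hab h.symm]
  set u := √a with hu
  set v := √b with hv
  have hu2 : a = u ^ 2 := (Real.sq_sqrt ha).symm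
  have hv2 : b = v ^ 2 := (Real.sq_sqrt hb).symm
  have hv0 : 0 < v := Real.sqrt_pos.mpr h
  have hu0 : 0 ≤ u := Real.sqrt_nonneg a
  have h1 : √(a / b) = u / v := by rw [Real.sqrt_div ha]
  have h2 : (u - v) / (u + v) ≤ logTilt a b := by
    have := Real.one_sub_inv_le_log_of_pos (x := (1 + √(a / b)) / 2)
      (lt_of_lt_of_le (by norm_num) (half_le_tilt a b))
    refine le_trans (le_of_eq ?_) this
    rw [h1]
    field_simp
    ring
  have h3 : u ^ 2 * ((u - v) / (u + v)) - ((u - v) ^ 2 / 4 + (u ^ 2 - v ^ 2) / 4)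
      = (u - v) ^ 2 * u / (2 * (u + v)) := by
    field_simp
    ring
  have h4 : 0 ≤ (u - v) ^ 2 * u / (2 * (u + v)) := by positivity
  have h5 := mul_le_mul_of_nonneg_left h2 (sq_nonneg u)
  rw [hu2, hv2] at *
  linarith

theorem hellingerSq_div_four_le_tsum_logTilt (hp : ∀ w, 0 ≤ p w) (hq : ∀ w, 0 ≤ q w)
    (hps : HasSum p 1) (hqs : HasSum q 1) {C : ℝ} (hpq : ∀ w, p w ≤ C * q w) :
    hellingerSq p q / 4 ≤ ∑' w, p w * logTilt (p w) (q w) := by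
  have h1 := ((summable_hellingerSq hp hq hps.summable hqs.summable).hasSum.div_const 4).add
    ((hps.sub hqs).div_const 4)
  have hb : ∀ w, |logTilt (p w) (q w)| ≤ Real.log 2 + max 1 C := fun w => by
    refine abs_logTilt_le (le_max_left _ _) ?_
    refine div_le_of_le_mul₀ (hq w) (by positivity) ((hpq w).trans ?_)
    exact mul_le_mul_of_nonneg_right (le_max_right _ _) (hq w)
  have h2 : Summable fun w => p w * logTilt (p w) (q w) := by
    refine Summable.of_norm_bounded (hps.summable.mul_right (Real.log 2 + max 1 C)) fun w => ?_
    rw [Real.norm_eq_abs, abs_mul, abs_of_nonneg (hp w)]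
    exact mul_le_mul_of_nonneg_left (hb w) (hp w)
  have h3 := hasSum_le (fun w => mul_logTilt_ge (hp w) (hq w) fun h => ?_) h1 h2.hasSum
  · simpa [hellingerSq] using h3
  · exact le_antisymm (by simpa [h] using hpq w) (hp w)

end Hellinger

/-! ### Merging blocks of players -/

section Merge

variable {ι : Type*} [DecidableEq ι]

/-- The pairwise squared distances of `n` points add up to at most `2 n` times (each pair being
counted twice) the sum of the squared distances to any given point `c`. -/
theorem sum_sum_sq_sub_le {κ : Type*} (s : Finset κ) (v : κ → ℝ) (c : ℝ) :
    ∑ i ∈ s, ∑ j ∈ s, (v i - v j) ^ 2 ≤ 2 * #s * ∑ i ∈ s, (c - v i) ^ 2 := by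
  have h : ∑ i ∈ s, ∑ j ∈ s, (v i - v j) ^ 2
      = 2 * #s * ∑ i ∈ s, (c - v i) ^ 2 - 2 * (∑ i ∈ s, (c - v i)) ^ 2 := by
    have : ∀ i j, (v i - v j) ^ 2
        = (c - v i) ^ 2 + (c - v j) ^ 2 - 2 * ((c - v i) * (c - v j)) := fun i j => by ring
    simp only [this, sum_add_distrib, sum_sub_distrib, sum_const, nsmul_eq_mul, ← mul_sum,
      ← sum_mul]
    ring
  rw [h]
  nlinarith [sq_nonneg (∑ i ∈ s, (c - v i))]

/-- Merging the cheapest pair of `n` blocks at a time multiplies the total by at most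
`1 + 2 / (n (n - 1)) ≤ exp (2 / (n - 1) - 2 / n)`, and the product of these factors telescopes. -/
theorem merge_le (f : Finset ι → ℝ) (hf0 : ∀ A, 0 ≤ f A)
    (hf : ∀ (s : Finset ι) (A : ι → Finset ι), (s : Set ι).PairwiseDisjoint A →
      ∑ z ∈ s.offDiag, f (A z.1 ∪ A z.2) ≤ 2 * #s * ∑ i ∈ s, f (A i)) (n : ℕ) :
    ∀ (s : Finset ι) (A : ι → Finset ι), #s = n + 1 → (s : Set ι).PairwiseDisjoint A →
      f (s.biUnion A) ≤ Real.exp (2 - 2 / (n + 1)) * ∑ i ∈ s, f (A i) := by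
  induction n with
  | zero =>
    intro s A hs _
    obtain ⟨a, rfl⟩ := card_eq_one.mp hs
    simp
  | succ n ih =>
    intro s A hs hA
    set F := ∑ i ∈ s, f (A i) with hF
    have hF0 : 0 ≤ F := sum_nonneg fun i _ => hf0 _
    have hcard : (#s.offDiag : ℝ) = (n + 2) * (n + 1) := by
      rw [offDiag_card, hs]
      have : (n + 1 + 1) * (n + 1 + 1) - (n + 1 + 1) = (n + 2) * (n + 1) := by
        rw [Nat.sub_eq_iff_eq_add (by nlinarith)]; ring
      rw [this]; push_cast; ring
    have hsum : ∑ z ∈ s.offDiag, (f (A z.1) + f (A z.2)) = 2 * (n + 1) * F := by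
      have h1 : ∑ z ∈ s ×ˢ s, (f (A z.1) + f (A z.2)) = 2 * (n + 2) * F := by
        rw [sum_product]
        simp only [sum_add_distrib, sum_const, hs, nsmul_eq_mul, ← mul_sum, ← hF]
        push_cast; ring
      have h2 : ∑ z ∈ s.diag, (f (A z.1) + f (A z.2)) = 2 * F := by
        rw [sum_diag]
        simp only [sum_add_distrib, ← hF]
        ring
      rw [← diag_union_offDiag, sum_union (disjoint_diag_offDiag s), h2] at h1
      linarith
    have hex : ∃ z ∈ s.offDiag, f (A z.1 ∪ A z.2) - (f (A z.1) + f (A z.2))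
        ≤ 2 / ((n + 2) * (n + 1)) * F := by
      refine exists_le_of_sum_le ?_ ?_
      · rw [← card_pos, offDiag_card, hs]
        exact Nat.sub_pos_of_lt (by nlinarith)
      · rw [sum_sub_distrib, hsum, sum_const, nsmul_eq_mul, hcard]
        have := hf s A hA
        rw [hs] at this
        push_cast at this
        have e : ((n : ℝ) + 2) * (n + 1) * (2 / ((n + 2) * (n + 1)) * F) = 2 * F := by field_simp
        rw [e]
        linarith
    obtain ⟨⟨i, j⟩, hz, hij⟩ := hex
    obtain ⟨hi, hj, hne⟩ := mem_offDiag.mp hz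
    simp only at hi hj hne hij
    have hi' : i ∈ s.erase j := mem_erase.mpr ⟨hne, hi⟩
    have hupd : ∀ l ∈ (s.erase j).erase i, Function.update A i (A i ∪ A j) l = A l := fun l hl =>
      Function.update_of_ne (ne_of_mem_erase hl) _ _
    have key := ih (s.erase j) (Function.update A i (A i ∪ A j))
      (by rw [card_erase_of_mem hj, hs]; rfl) ?_
    · have hU : (s.erase j).biUnion (Function.update A i (A i ∪ A j)) = s.biUnion A := by
        rw [← insert_erase hi', biUnion_insert, Function.update_self, biUnion_congr rfl hupd]
        conv_rhs => rw [← insert_erase hj, ← insert_erase hi', biUnion_insert, biUnion_insert]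
        rw [← union_assoc, union_comm (A j)]
      have hS : ∑ l ∈ s.erase j, f (Function.update A i (A i ∪ A j) l)
          = F + (f (A i ∪ A j) - (f (A i) + f (A j))) := by
        rw [← add_sum_erase _ _ hi', Function.update_self,
          sum_congr rfl fun l hl => congrArg f (hupd l hl)]
        rw [hF, ← add_sum_erase _ _ hj, ← add_sum_erase _ _ hi']
        ring
      rw [hU, hS] at key
      refine key.trans ?_
      have h1 : F + (f (A i ∪ A j) - (f (A i) + f (A j)))
          ≤ Real.exp (2 / ((n + 2) * (n + 1))) * F := by
        have := Real.add_one_le_exp (2 / (((n : ℝ) + 2) * (n + 1)))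
        nlinarith
      refine (mul_le_mul_of_nonneg_left h1 (Real.exp_pos _).le).trans (le_of_eq ?_)
      rw [← mul_assoc, ← Real.exp_add]
      congr 2
      push_cast
      field_simp
      ring
    · intro a ha b hb hab
      have ha' := mem_of_mem_erase (mem_coe.mp ha)
      have hb' := mem_of_mem_erase (mem_coe.mp hb)
      have haj := ne_of_mem_erase (mem_coe.mp ha)
      have hbj := ne_of_mem_erase (mem_coe.mp hb)
      have d1 := fun (x y) (hx : x ∈ s) (hy : y ∈ s) (h : x ≠ y) => hA hx hy h
      simp only [Function.onFun] at d1 ⊢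
      by_cases hai : a = i
      · subst hai
        rw [Function.update_self, Function.update_of_ne hab.symm, disjoint_union_left]
        exact ⟨d1 _ _ hi hb' hab, d1 _ _ hj hb' hbj.symm⟩
      · by_cases hbi : b = i
        · subst hbi
          rw [Function.update_self, Function.update_of_ne hab, disjoint_union_right]
          exact ⟨d1 _ _ ha' hi hab, d1 _ _ ha' hj haj⟩
        · rw [Function.update_of_ne hai, Function.update_of_ne hbi]
          exact d1 _ _ ha' hb' hab

/-- **Superadditivity up to a constant.** If the densities `π A` satisfy the cut-and-paste identity
`π A * π B = π ∅ * π (A ∪ B)` for disjoint `A`, `B`, then the squared Hellinger distance between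
`π ∅` and `π univ` is at most `e²` times the sum of those between `π ∅` and `π {i}`. -/
theorem hellingerSq_univ_le {W : Type*} [Fintype ι] [Nonempty ι] (π : Finset ι → W → ℝ)
    (h0 : ∀ A w, 0 ≤ π A w)
    (h1 : ∀ A, HasSum (π A) 1)
    (hcut : ∀ A B, Disjoint A B → ∀ w, π A w * π B w = π ∅ w * π (A ∪ B) w) :
    hellingerSq (π ∅) (π univ) ≤ Real.exp 2 * ∑ i, hellingerSq (π ∅) (π {i}) := by
  obtain ⟨n, hn⟩ : ∃ n, #(univ : Finset ι) = n + 1 :=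
    Nat.exists_eq_succ_of_ne_zero (card_ne_zero.mpr univ_nonempty)
  have hs : ∀ A B, Summable fun w => (√(π A w) - √(π B w)) ^ 2 := fun A B =>
    summable_hellingerSq (h0 A) (h0 B) (h1 A).summable (h1 B).summable
  have key := merge_le (fun A => hellingerSq (π ∅) (π A)) (fun A => hellingerSq_nonneg) ?_ n univ
    (fun i => {i}) hn ?_
  · simp only [biUnion_singleton_eq_self] at key
    refine key.trans (mul_le_mul_of_nonneg_right (Real.exp_le_exp.mpr ?_)
      (sum_nonneg fun i _ => hellingerSq_nonneg))
    have : (0 : ℝ) ≤ 2 / (n + 1) := by positivity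
    linarith
  · intro s A hA
    have e : ∑ z ∈ s.offDiag, hellingerSq (π ∅) (π (A z.1 ∪ A z.2))
        = ∑ i ∈ s, ∑ j ∈ s, hellingerSq (π (A i)) (π (A j)) := by
      rw [← sum_product', ← diag_union_offDiag, sum_union (disjoint_diag_offDiag s), sum_diag]
      simp only [hellingerSq_self, sum_const_zero, zero_add]
      refine sum_congr rfl fun z hz => ?_
      obtain ⟨hi, hj, hne⟩ := mem_offDiag.mp hz
      exact (hellingerSq_eq_of_mul_eq (h0 _) (h0 _) (h0 _) (h0 _) (h1 _) (h1 _) (h1 _) (h1 _)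
        (hcut _ _ (hA hi hj hne))).symm
    rw [e]
    have hl : HasSum (fun w => ∑ i ∈ s, ∑ j ∈ s, (√(π (A i) w) - √(π (A j) w)) ^ 2)
        (∑ i ∈ s, ∑ j ∈ s, hellingerSq (π (A i)) (π (A j))) :=
      hasSum_sum fun i _ => hasSum_sum fun j _ => (hs (A i) (A j)).hasSum
    have hr : HasSum (fun w => 2 * #s * ∑ i ∈ s, (√(π ∅ w) - √(π (A i) w)) ^ 2)
        (2 * #s * ∑ i ∈ s, hellingerSq (π ∅) (π (A i))) :=
      (hasSum_sum fun i _ => (hs ∅ (A i)).hasSum).mul_left _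
    exact hasSum_le (fun w => sum_sum_sq_sub_le s _ _) hl hr
  · intro i _ j _ hij
    simpa [Function.onFun] using hij

end Merge

/-! ### A variational lower bound for the mutual information -/

/-- Fenchel's inequality for `klFun` and its conjugate `exp - 1`. -/
theorem mul_sub_exp_le_klFun {x : ℝ} (hx : 0 ≤ x) (g : ℝ) :
    x * g - Real.exp g + 1 ≤ InformationTheory.klFun x := by
  rw [InformationTheory.klFun_apply]
  rcases hx.eq_or_lt with rfl | h
  · simpa using (Real.exp_pos g).le
  · have h1 := Real.add_one_le_exp (g - Real.log x)
    rw [Real.exp_sub, Real.exp_log h, le_div_iff₀ h] at h1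
    linarith

/-- A weak form of the Donsker–Varadhan formula, with `E - 1` in place of `log E`. -/
theorem ofReal_integral_le_klDiv {α : Type*} [MeasurableSpace α] (μ ν : Measure α)
    [IsProbabilityMeasure μ] [IsProbabilityMeasure ν] {g : α → ℝ} (hg : Measurable g) {C : ℝ}
    (hC : ∀ a, |g a| ≤ C) :
    ENNReal.ofReal (∫ a, g a ∂μ - ∫ a, Real.exp (g a) ∂ν + 1) ≤ InformationTheory.klDiv μ ν := by
  by_cases h : InformationTheory.klDiv μ ν = ∞
  · simp [h]
  obtain ⟨hac, hint⟩ := InformationTheory.klDiv_ne_top_iff.mp h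
  rw [← ENNReal.ofReal_toReal h, InformationTheory.toReal_klDiv_eq_integral_klFun hac]
  refine ENNReal.ofReal_le_ofReal ?_
  have i1 : Integrable g μ := Integrable.of_bound hg.aestronglyMeasurable C (.of_forall hC)
  have i2 : Integrable (fun a => Real.exp (g a)) ν := by
    refine Integrable.of_bound (Real.measurable_exp.comp hg).aestronglyMeasurable (Real.exp C)
      (.of_forall fun a => ?_)
    rw [Real.norm_eq_abs, abs_of_pos (Real.exp_pos _)]
    exact Real.exp_le_exp.mpr (abs_le.mp (hC a)).2
  have i3 : Integrable (fun a => (μ.rnDeriv ν a).toReal * g a) ν := by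
    simpa using (integrable_rnDeriv_smul_iff hac).mpr i1
  have e : ∫ a, g a ∂μ - ∫ a, Real.exp (g a) ∂ν + 1
      = ∫ a, ((μ.rnDeriv ν a).toReal * g a - Real.exp (g a) + 1) ∂ν := by
    have i4 : Integrable (fun a => (μ.rnDeriv ν a).toReal * g a - Real.exp (g a)) ν := i3.sub i2
    rw [integral_add i4 (integrable_const _), integral_sub i3 i2]
    have := integral_rnDeriv_smul (f := g) hac
    simp only [smul_eq_mul] at this
    rw [this]
    simp
  rw [e]
  exact integral_mono ((i3.sub i2).add (integrable_const _))
    ((InformationTheory.integrable_klFun_rnDeriv_iff hac).mpr hint)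
    fun a => mul_sub_exp_le_klFun ENNReal.toReal_nonneg _

/-- The variational bound for a kernel `κ`, with the exponential moment controlled separately for
each value of the second variable. Passing from nats to bits only helps, as `log 2 ≤ 1`. -/
theorem le_mutualInfo {α β : Type*} [Fintype α] [Countable β] (μ : PMF α)
    (κ : α → PMF β) (g : α → β → ℝ) {C K : ℝ} (hC : ∀ a b, |g a b| ≤ C)
    (hK : ∀ b, ∑ a, (μ a).toReal * Real.exp (g a b) ≤ K) :
    ENNReal.ofReal (∑ a, (μ a).toReal * ∑' b, (κ a b).toReal * g a b - (K - 1)) ≤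
      mutualInfo (μ.bind fun a => (κ a).map fun b => (a, b)) := by
  set p := μ.bind fun a => (κ a).map fun b => (a, b) with hp
  let _ : MeasurableSpace α := ⊤
  let _ : MeasurableSpace β := ⊤
  have hfst : p.map Prod.fst = μ := by
    rw [hp, PMF.map_bind]
    simp only [PMF.map_comp]
    have : ∀ a : α, (Prod.fst ∘ fun b : β => (a, b)) = Function.const β a := fun a => rfl
    simp [this, PMF.map_const]
  have happ : ∀ a b, p (a, b) = μ a * κ a b := by
    intro a b
    rw [hp, PMF.bind_apply, tsum_eq_single a]
    · congr 1
      rw [PMF.map_apply, tsum_eq_single b]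
      · simp
      · intro b' hb'; simp [hb'.symm]
    · intro a' ha'
      have : (PMF.map (fun b => (a', b)) (κ a')) (a, b) = 0 := by
        rw [PMF.map_apply]
        simp [ha'.symm]
      rw [this, mul_zero]
  set ν := p.map Prod.snd
  have hmeas : Measurable fun z : α × β => g z.1 z.2 := measurable_of_countable _
  have h1 := ofReal_integral_le_klDiv p.toMeasure (μ.toMeasure.prod ν.toMeasure) hmeas
    fun z => hC z.1 z.2
  have hI : ∫ z, g z.1 z.2 ∂p.toMeasure = ∑ a, (μ a).toReal * ∑' b, (κ a b).toReal * g a b := by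
    have hint : Integrable (fun z : α × β => g z.1 z.2) p.toMeasure :=
      Integrable.of_bound hmeas.aestronglyMeasurable C (.of_forall fun z => hC z.1 z.2)
    rw [PMF.integral_eq_tsum p _ hint]
    have hs : Summable fun z : α × β => (p z).toReal • g z.1 z.2 := by
      refine Summable.of_norm_bounded ((ENNReal.summable_toReal p.tsum_coe_ne_top).mul_right C)
        fun z => ?_
      rw [norm_smul, Real.norm_eq_abs, Real.norm_eq_abs, abs_of_nonneg ENNReal.toReal_nonneg]
      exact mul_le_mul_of_nonneg_left (hC _ _) ENNReal.toReal_nonneg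
    rw [hs.tsum_prod, tsum_fintype]
    refine sum_congr rfl fun a _ => ?_
    rw [← tsum_mul_left]
    refine tsum_congr fun b => ?_
    simp only [happ, ENNReal.toReal_mul, smul_eq_mul, mul_assoc]
  have hE : ∫ z, Real.exp (g z.1 z.2) ∂(μ.toMeasure.prod ν.toMeasure) ≤ K := by
    have hint : Integrable (fun z : α × β => Real.exp (g z.1 z.2))
        (μ.toMeasure.prod ν.toMeasure) := by
      refine Integrable.of_bound (measurable_of_countable _).aestronglyMeasurable (Real.exp C)
        (.of_forall fun z => ?_)
      rw [Real.norm_eq_abs, abs_of_pos (Real.exp_pos _)]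
      exact Real.exp_le_exp.mpr (abs_le.mp (hC _ _)).2
    rw [integral_prod_symm _ hint]
    have : ∫ _ : β, K ∂ν.toMeasure = K := by simp
    rw [← this]
    refine integral_mono hint.integral_prod_right (integrable_const _) fun b => ?_
    simp only
    rw [PMF.integral_eq_sum]
    simpa using hK b
  have hlog : ENNReal.ofReal (Real.log 2) ≤ 1 := by
    rw [ENNReal.ofReal_le_one]
    linarith [Real.log_two_lt_d9]
  rw [mutualInfo, hfst]
  refine le_trans (le_trans (ENNReal.ofReal_le_ofReal ?_) h1) ?_
  · rw [hI]; linarith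
  · rw [ENNReal.le_div_iff_mul_le (.inl (by simpa using Real.log_pos one_lt_two))
      (.inl ENNReal.ofReal_ne_top)]
    exact mul_le_of_le_one_right' hlog

/-! ### The transcript of a chain of messages -/

/-- The message received by player `i` when the messages sent are `w` (the empty string for the
first player). -/
def prevMessage {n : ℕ} (prev : List Bool) (w : Fin n → List Bool) (i : Fin n) : List Bool :=
  Fin.cons (α := fun _ => List Bool) prev w i.castSucc

theorem chainLaw_apply (n : ℕ) : ∀ (f : Fin n → List Bool → PMF (List Bool)) (prev : List Bool)
    (w : Fin n → List Bool), chainLaw n f prev w = ∏ i, f i (prevMessage prev w i) (w i) := by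
  induction n with
  | zero =>
    intro f prev w
    simp [chainLaw, PMF.pure_apply, Subsingleton.elim w Fin.elim0]
  | succ n ih =>
    intro f prev w
    rw [chainLaw, PMF.bind_apply, Fin.prod_univ_succ, tsum_eq_single (w 0)]
    · congr 1
      rw [PMF.map_apply, tsum_eq_single (Fin.tail w)]
      · rw [if_pos (Fin.cons_self_tail w).symm, ih]
        refine prod_congr rfl fun i _ => ?_
        congr 2
        have h : (Fin.cons (w 0) (Fin.tail w) : Fin (n + 1) → List Bool) = w :=
          Fin.cons_self_tail w
        simp only [prevMessage, Fin.castSucc_succ, Fin.cons_succ]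
        rw [h]
      · intro v hv
        rw [if_neg]
        intro h
        exact hv (by rw [h, Fin.tail_cons])
    · intro a ha
      rw [PMF.map_apply, ENNReal.tsum_eq_zero.mpr, mul_zero]
      intro v
      rw [if_neg]
      intro h
      exact ha (by rw [h, Fin.cons_zero])

theorem hasSum_toReal {α : Type*} (p : PMF α) : HasSum (fun a => (p a).toReal) 1 := by
  have := ENNReal.hasSum_toReal p.tsum_coe_ne_top
  rwa [← ENNReal.tsum_toReal_eq fun a => p.apply_ne_top a, p.tsum_coe, ENNReal.toReal_one] at this

/-! ### Averages over subsets of fixed size -/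

section Subsets

variable {U : Type*} [DecidableEq U]

/-- A random `k`-element subset of `V` contains a given point with probability `k / |V|`. -/
theorem card_filter_mem_mul_card {k : ℕ} {V : Finset U} {x : U} (hx : x ∈ V) :
    #{S ∈ V.powersetCard k | x ∈ S} * #V = k * #(V.powersetCard k) := by
  rcases k with _ | k
  · simp
  have h := card_filter_powersetCard_subset {x} V (k + 1) (by simpa using hx) (by simp)
  simp only [singleton_subset_iff, card_singleton, Nat.add_sub_cancel] at h
  rw [h, card_powersetCard]
  obtain ⟨n, hn⟩ : ∃ n, #V = n + 1 := Nat.exists_eq_succ_of_ne_zero (card_ne_zero_of_mem hx)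
  rw [hn, Nat.add_sub_cancel, mul_comm, Nat.add_one_mul_choose_eq, mul_comm]

/-- The elementary symmetric polynomial of degree `k` at nonnegative reals is at most the `k`-th
power of their sum divided by `k!`. -/
theorem factorial_mul_esymm_le (k : ℕ) (s : Finset U) {F : U → ℝ} (hF : ∀ x, 0 ≤ F x) :
    (k.factorial : ℝ) * ∑ S ∈ s.powersetCard k, ∏ x ∈ S, F x ≤ (∑ x ∈ s, F x) ^ k := by
  induction s using Finset.induction_on generalizing k with
  | empty =>
    cases k with
    | zero => simp
    | succ k => rw [powersetCard_eq_empty.mpr (by simp)]; simp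
  | insert a s ha ih =>
    cases k with
    | zero => simp
    | succ k =>
      have hdisj : Disjoint (s.powersetCard (k + 1)) ((s.powersetCard k).image (insert a)) := by
        rw [disjoint_left]
        intro S hS hS'
        obtain ⟨T, _, rfl⟩ := mem_image.mp hS'
        exact ha ((mem_powersetCard.mp hS).1 (mem_insert_self _ _))
      have hinj : Set.InjOn (insert a) (s.powersetCard k : Set (Finset U)) := by
        intro S hS T hT h
        have hS' : a ∉ S := fun h => ha ((mem_powersetCard.mp (mem_coe.mp hS)).1 h)
        have hT' : a ∉ T := fun h => ha ((mem_powersetCard.mp (mem_coe.mp hT)).1 h)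
        rw [← erase_insert hS', h, erase_insert hT']
      have himg : ∑ S ∈ (s.powersetCard k).image (insert a), ∏ x ∈ S, F x
          = F a * ∑ S ∈ s.powersetCard k, ∏ x ∈ S, F x := by
        rw [sum_image hinj, mul_sum]
        refine sum_congr rfl fun S hS => prod_insert fun h => ha ((mem_powersetCard.mp hS).1 h)
      rw [powersetCard_succ_insert ha, sum_union hdisj, himg, sum_insert ha]
      set σ := ∑ x ∈ s, F x
      have hσ : 0 ≤ σ := sum_nonneg fun x _ => hF x
      have h1 := ih (k + 1)
      have h2 := mul_le_mul_of_nonneg_left (ih k) (hF a)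
      have h3 : σ ^ (k + 1) + (k + 1) * (F a * σ ^ k) ≤ (F a + σ) ^ (k + 1) := by
        have := pow_add_mul_le_add_pow_of_sq_nonneg hσ (sq_nonneg (F a))
          (sq_nonneg (σ + F a)) (by linarith [hF a]) (k + 1)
        rw [add_comm (F a), Nat.add_sub_cancel] at *
        push_cast at this
        linarith
      have h4 : ((k + 1).factorial : ℝ) = (k + 1) * k.factorial := by
        rw [Nat.factorial_succ]; push_cast; ring
      have h5 : (0 : ℝ) ≤ k + 1 := by positivity
      have h6 := mul_le_mul_of_nonneg_left h2 h5
      rw [mul_add]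
      calc _ = ((k + 1).factorial : ℝ) * ∑ S ∈ s.powersetCard (k + 1), ∏ x ∈ S, F x
          + (k + 1) * (F a * (k.factorial * ∑ S ∈ s.powersetCard k, ∏ x ∈ S, F x)) := by
            rw [h4]; ring
        _ ≤ _ := by linarith

end Subsets

section Planted

variable {t : ℕ} {U : Type*} [Fintype U] [DecidableEq U]

/-- Conditioning a random `k`-set on containing `x` makes it no more likely to contain another
given point than the bound `k / |U|` for an unconditioned set. -/
theorem card_filter_mem_filter_mul_card_le {k : ℕ} (hk : k ≤ Fintype.card U) {x z : U}
    (hz : z ≠ x) :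
    #{S ∈ {S ∈ (univ : Finset U).powersetCard k | x ∈ S} | z ∈ S} * Fintype.card U
      ≤ k * #{S ∈ (univ : Finset U).powersetCard k | x ∈ S} := by
  rcases k with _ | _ | k
  · simp
  · suffices h : {S ∈ {S ∈ (univ : Finset U).powersetCard 1 | x ∈ S} | z ∈ S} = ∅ by simp [h]
    refine filter_eq_empty_iff.mpr fun S hS hzS => ?_
    obtain ⟨h1, h2⟩ := mem_filter.mp hS
    exact hz (card_le_one.mp (mem_powersetCard.mp h1).2.le _ hzS _ h2)
  have h1 := card_filter_powersetCard_subset {x} (univ : Finset U) (k + 2) (by simp) (by simp)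
  have h2 := card_filter_powersetCard_subset {x, z} (univ : Finset U) (k + 2) (by simp)
    (by rw [card_pair hz.symm]; omega)
  simp only [singleton_subset_iff, card_singleton, card_univ, insert_subset_iff,
    card_pair hz.symm] at h1 h2
  rw [filter_filter, h1, h2]
  obtain ⟨n, hn⟩ : ∃ n, Fintype.card U = n + 2 := ⟨Fintype.card U - 2, by omega⟩
  have e1 : n + 2 - 1 = n + 1 := by omega
  have e2 : k + 2 - 1 = k + 1 := by omega
  rw [hn, Nat.add_sub_cancel, Nat.add_sub_cancel, e1, e2]
  have h3 := Nat.add_one_mul_choose_eq n k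
  have h4 : n.choose k ≤ (n + 1).choose (k + 1) := by
    rw [Nat.choose_succ_succ]; omega
  nlinarith

theorem card_piFinset_ite {α : Type*} (A : Finset (Fin t)) (B C : Finset α) :
    #(Fintype.piFinset fun i : Fin t => if i ∈ A then B else C) = #B ^ #A * #C ^ (t - #A) := by
  rw [Fintype.card_piFinset]
  simp only [apply_ite card]
  rw [prod_ite, prod_const, prod_const, filter_mem_eq_inter, univ_inter]
  congr 2
  rw [filter_notMem_eq_sdiff, card_sdiff_of_subset (subset_univ _), card_univ, Fintype.card_fin]

/-- If every point of `V` lies in at most a fraction `k / |U|` of the members of `𝓕`, then among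
the `t`-tuples of members of `𝓕` at most a fraction `t² k² / |U|` has two entries that meet
inside `V`. -/
theorem card_filter_meet_mul_card_le (𝓕 : Finset (Finset U)) (V : Finset U) (k : ℕ)
    (h : ∀ z ∈ V, #{S ∈ 𝓕 | z ∈ S} * Fintype.card U ≤ k * #𝓕) :
    #{S ∈ Fintype.piFinset fun _ : Fin t => 𝓕 | ∃ i j, i ≠ j ∧ ∃ z ∈ V, z ∈ S i ∧ z ∈ S j}
      * Fintype.card U ≤ t ^ 2 * k ^ 2 * #(Fintype.piFinset fun _ : Fin t => 𝓕) := by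
  set N := Fintype.card U with hN
  set Ω := Fintype.piFinset fun _ : Fin t => 𝓕 with hΩ
  rcases Nat.eq_zero_or_pos N with h0 | hN0
  · simp [h0]
  have hpair : ∀ i j : Fin t, i ≠ j → ∀ z ∈ V,
      #{S ∈ Ω | z ∈ S i ∧ z ∈ S j} * N ^ 2 ≤ k ^ 2 * #Ω := by
    intro i j hij z hz
    have e : {S ∈ Ω | z ∈ S i ∧ z ∈ S j} = Fintype.piFinset fun l : Fin t =>
        if l ∈ ({i, j} : Finset (Fin t)) then {S ∈ 𝓕 | z ∈ S} else 𝓕 := by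
      ext S
      simp only [hΩ, mem_filter, Fintype.mem_piFinset, mem_insert, mem_singleton]
      constructor
      · rintro ⟨h1, h2, h3⟩ l
        split_ifs with hl
        · rcases hl with rfl | rfl <;> simp [h1, h2, h3]
        · exact h1 l
      · intro h1
        refine ⟨fun l => ?_, ?_, ?_⟩
        · have := h1 l
          split_ifs at this
          · exact (mem_filter.mp this).1
          · exact this
        · have := h1 i; simp only [true_or, if_true, mem_filter] at this; exact this.2
        · have := h1 j; simp only [or_true, if_true, mem_filter] at this; exact this.2
    have ht : 2 ≤ t := by
      have := card_le_univ ({i, j} : Finset (Fin t))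
      rwa [card_pair hij, Fintype.card_fin] at this
    have hc : #Ω = #𝓕 ^ 2 * #𝓕 ^ (t - 2) := by
      rw [hΩ, Fintype.card_piFinset, prod_const, card_univ, Fintype.card_fin, ← pow_add,
        Nat.add_sub_cancel' ht]
    rw [e, card_piFinset_ite, card_pair hij, hc]
    have := Nat.mul_le_mul_right (#𝓕 ^ (t - 2)) (Nat.pow_le_pow_left (h z hz) 2)
    calc _ = (#{S ∈ 𝓕 | z ∈ S} * N) ^ 2 * #𝓕 ^ (t - 2) := by ring
      _ ≤ _ := this
      _ = _ := by ring
  have hsub : {S ∈ Ω | ∃ i j, i ≠ j ∧ ∃ z ∈ V, z ∈ S i ∧ z ∈ S j} ⊆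
      ((univ : Finset (Fin t)).offDiag ×ˢ V).biUnion fun q =>
        {S ∈ Ω | q.2 ∈ S q.1.1 ∧ q.2 ∈ S q.1.2} := by
    intro S hS
    obtain ⟨h1, i, j, hij, z, hz, h2, h3⟩ := mem_filter.mp hS
    exact mem_biUnion.mpr ⟨((i, j), z), by simp [hij, hz], by simp [h1, h2, h3]⟩
  have hbound : #{S ∈ Ω | ∃ i j, i ≠ j ∧ ∃ z ∈ V, z ∈ S i ∧ z ∈ S j} * N ^ 2
      ≤ (t ^ 2 * N) * (k ^ 2 * #Ω) := by
    refine (Nat.mul_le_mul_right _ ((card_le_card hsub).trans card_biUnion_le)).trans ?_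
    rw [sum_mul]
    refine (sum_le_card_nsmul _ _ (k ^ 2 * #Ω) fun q hq => ?_).trans ?_
    · obtain ⟨h1, h2⟩ := mem_product.mp hq
      exact hpair _ _ (mem_offDiag.mp h1).2.2 _ h2
    · rw [smul_eq_mul, card_product]
      refine Nat.mul_le_mul_right _ (Nat.mul_le_mul ?_ (card_le_univ V))
      rw [offDiag_card, card_univ, Fintype.card_fin]
      exact (Nat.sub_le _ _).trans (by rw [sq])
  refine Nat.le_of_mul_le_mul_right (c := N) ?_ hN0
  calc _ = #{S ∈ Ω | ∃ i j, i ≠ j ∧ ∃ z ∈ V, z ∈ S i ∧ z ∈ S j} * N ^ 2 := by ring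
    _ ≤ _ := hbound
    _ = _ := by ring

/-! ### Planting a common element -/

/-- The `t`-tuples of `k`-element subsets of `U` in which the players in `A` hold the point `x`. -/
def plantedSets (t k : ℕ) (x : U) (A : Finset (Fin t)) : Finset (Fin t → Finset U) :=
  Fintype.piFinset fun i =>
    if i ∈ A then {S ∈ (univ : Finset U).powersetCard k | x ∈ S} else univ.powersetCard k

/-- The probability of the transcript `w` when the inputs are uniformly random `k`-element sets,
those of the players in `A` being conditioned on containing `x`. -/
noncomputable def plantedLaw (P : OneWayProtocol t U) (k : ℕ) (x : U) (A : Finset (Fin t))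
    (w : Fin t → List Bool) : ℝ :=
  (∑ S ∈ plantedSets t k x A, (P.transcript S w).toReal) / #(plantedSets t k x A)

theorem mem_plantedSets {k : ℕ} {x : U} {A : Finset (Fin t)} {S : Fin t → Finset U} :
    S ∈ plantedSets t k x A ↔ (∀ i, #(S i) = k) ∧ ∀ i ∈ A, x ∈ S i := by
  simp only [plantedSets, Fintype.mem_piFinset]
  constructor
  · intro h
    refine ⟨fun i => ?_, fun i hi => ?_⟩
    · have := h i
      split_ifs at this
      · exact (mem_powersetCard.mp (mem_filter.mp this).1).2
      · exact (mem_powersetCard.mp this).2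
    · have := h i
      rw [if_pos hi] at this
      exact (mem_filter.mp this).2
  · rintro ⟨h1, h2⟩ i
    split_ifs with hi <;> simp [h1 i, mem_powersetCard]
    exact h2 i hi

theorem plantedSets_empty (k : ℕ) (x : U) :
    plantedSets t k x ∅ = Fintype.piFinset fun _ => (univ : Finset U).powersetCard k := by
  simp [plantedSets]

theorem plantedSets_univ (k : ℕ) (x : U) :
    plantedSets t k x univ
      = Fintype.piFinset fun _ => {S ∈ (univ : Finset U).powersetCard k | x ∈ S} := by
  simp [plantedSets]

theorem card_plantedSets_singleton (k : ℕ) (x : U) (i : Fin t) :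
    #(plantedSets t k x {i}) * Fintype.card U = k * #(plantedSets t k x ∅) := by
  have ht : 0 < t := i.pos
  rw [plantedSets, plantedSets, card_piFinset_ite, card_piFinset_ite, card_singleton, card_empty,
    pow_zero, one_mul, pow_one, Nat.sub_zero, mul_right_comm, ← card_univ,
    card_filter_mem_mul_card (mem_univ x), mul_assoc, ← pow_succ', Nat.sub_add_cancel ht]

variable {k : ℕ} {x : U} {A B : Finset (Fin t)}

theorem card_plantedSets_pos (hk0 : 0 < k) (hk : k ≤ Fintype.card U) (x : U)
    (A : Finset (Fin t)) : 0 < #(plantedSets t k x A) := by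
  have h1 : 0 < #((univ : Finset U).powersetCard k) := by
    rw [card_powersetCard]; exact Nat.choose_pos hk
  have h2 : 0 < #{S ∈ (univ : Finset U).powersetCard k | x ∈ S} := by
    have h := card_filter_mem_mul_card (k := k) (mem_univ x)
    rw [pos_iff_ne_zero]
    intro h0
    rw [h0, zero_mul] at h
    exact (Nat.mul_pos hk0 h1).ne h
  rw [plantedSets, card_piFinset_ite]
  positivity

variable (P : OneWayProtocol t U)

theorem plantedLaw_nonneg (w : Fin t → List Bool) : 0 ≤ plantedLaw P k x A w :=
  div_nonneg (sum_nonneg fun _ _ => ENNReal.toReal_nonneg) (Nat.cast_nonneg _)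

theorem hasSum_plantedLaw_mul {φ : (Fin t → List Bool) → ℝ} {G : (Fin t → Finset U) → ℝ}
    (h : ∀ S, HasSum (fun w => (P.transcript S w).toReal * φ w) (G S)) :
    HasSum (fun w => plantedLaw P k x A w * φ w)
      ((∑ S ∈ plantedSets t k x A, G S) / #(plantedSets t k x A)) := by
  have := (hasSum_sum (s := plantedSets t k x A) fun S _ => h S).div_const
    (#(plantedSets t k x A) : ℝ)
  have e : (fun w => plantedLaw P k x A w * φ w) = fun w =>
      (∑ S ∈ plantedSets t k x A, (P.transcript S w).toReal * φ w) / #(plantedSets t k x A) := by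
    funext w
    rw [plantedLaw, div_mul_eq_mul_div, sum_mul]
  rwa [e]

theorem hasSum_plantedLaw (hk0 : 0 < k) (hk : k ≤ Fintype.card U) :
    HasSum (plantedLaw P k x A) 1 := by
  have h := hasSum_plantedLaw_mul (k := k) (x := x) (A := A) P (φ := fun _ => 1) (G := fun _ => 1)
    fun S => by simpa using hasSum_toReal (P.transcript S)
  have h0 : (#(plantedSets t k x A) : ℝ) ≠ 0 := by
    exact_mod_cast (card_plantedSets_pos hk0 hk x A).ne'
  simpa [div_self h0] using h

theorem plantedLaw_eq_prod (w : Fin t → List Bool) :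
    plantedLaw P k x A w = ∏ i,
      (∑ S ∈ if i ∈ A then {S ∈ (univ : Finset U).powersetCard k | x ∈ S}
          else univ.powersetCard k, (P.player i (prevMessage [] w i) S (w i)).toReal) /
        #(if i ∈ A then {S ∈ (univ : Finset U).powersetCard k | x ∈ S}
          else univ.powersetCard k) := by
  rw [prod_div_distrib, prod_univ_sum, plantedLaw, plantedSets, Fintype.card_piFinset]
  push_cast
  congr 1
  refine sum_congr rfl fun S _ => ?_
  rw [OneWayProtocol.transcript, chainLaw_apply, ENNReal.toReal_prod]

/-- **Cut and paste.** The inputs being independent, each player contributes its own factor to the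
law of the transcript, and the factor depends only on whether the player is planted. -/
theorem plantedLaw_mul_plantedLaw (hAB : Disjoint A B) (w : Fin t → List Bool) :
    plantedLaw P k x A w * plantedLaw P k x B w
      = plantedLaw P k x ∅ w * plantedLaw P k x (A ∪ B) w := by
  simp only [plantedLaw_eq_prod, ← prod_mul_distrib]
  refine prod_congr rfl fun i _ => ?_
  by_cases hA : i ∈ A
  · have hB : i ∉ B := disjoint_left.mp hAB hA
    simp only [hA, hB, mem_union, notMem_empty, if_true, if_false, or_false]
    ring
  · by_cases hB : i ∈ B <;> simp [hA, hB]

theorem plantedLaw_empty_congr (x y : U) : plantedLaw P k x ∅ = plantedLaw P k y ∅ := by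
  funext w
  simp [plantedLaw, plantedSets_empty]

theorem sum_plantedSets_singleton (x₀ : U) (i : Fin t) (G : U → (Fin t → Finset U) → ℝ) :
    ∑ x, ∑ S ∈ plantedSets t k x {i}, G x S
      = ∑ S ∈ plantedSets t k x₀ ∅, ∑ x ∈ S i, G x S := by
  refine sum_comm' fun x S => ?_
  simp only [mem_plantedSets, mem_singleton, forall_eq, notMem_empty, false_implies,
    implies_true, and_true, mem_univ, true_and]
  tauto

/-- A random member of a random `k`-set is uniformly distributed. -/
theorem sum_plantedLaw_singleton (hk0 : 0 < k) (hk : k ≤ Fintype.card U) (x₀ : U) (i : Fin t)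
    (w : Fin t → List Bool) :
    ∑ x, plantedLaw P k x {i} w = Fintype.card U * plantedLaw P k x₀ ∅ w := by
  have hc : ∀ x : U, (#(plantedSets t k x {i}) : ℝ) * Fintype.card U
      = k * #(plantedSets t k x₀ ∅) := fun x => by
    rw [plantedSets_empty k x₀, ← plantedSets_empty k x]
    exact_mod_cast card_plantedSets_singleton k x i
  have h0 := card_plantedSets_pos hk0 hk x₀ (∅ : Finset (Fin t))
  have h0' : (0 : ℝ) < #(plantedSets t k x₀ ∅ : Finset (Fin t → Finset U)) := by exact_mod_cast h0
  have hk' : (0 : ℝ) < k := by exact_mod_cast hk0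
  have h1 := sum_plantedSets_singleton (k := k) x₀ i fun _ S => (P.transcript S w).toReal
  have h2 : ∀ S ∈ plantedSets t k x₀ ∅, ∑ _x ∈ S i, (P.transcript S w).toReal
      = k * (P.transcript S w).toReal := fun S hS => by
    rw [sum_const, (mem_plantedSets.mp hS).1 i, nsmul_eq_mul]
  rw [sum_congr rfl h2, ← mul_sum] at h1
  have h3 : ∀ x : U, plantedLaw P k x {i} w = (Fintype.card U / (k * #(plantedSets t k x₀ ∅)))
      * ∑ S ∈ plantedSets t k x {i}, (P.transcript S w).toReal := fun x => by
    have hp : (0 : ℝ) < #(plantedSets t k x {i}) := by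
      exact_mod_cast card_plantedSets_pos hk0 hk x {i}
    have hN : (Fintype.card U : ℝ) ≠ 0 := by
      have : 0 < Fintype.card U := hk0.trans_le hk
      positivity
    rw [plantedLaw, ← hc x]
    field_simp
  rw [sum_congr rfl fun x _ => h3 x, ← mul_sum, h1, plantedLaw]
  field_simp

theorem plantedLaw_singleton_le (hk0 : 0 < k) (hk : k ≤ Fintype.card U) (i : Fin t)
    (w : Fin t → List Bool) :
    plantedLaw P k x {i} w ≤ Fintype.card U * plantedLaw P k x ∅ w := by
  rw [← sum_plantedLaw_singleton P hk0 hk x i w]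
  exact single_le_sum (f := fun x => plantedLaw P k x {i} w)
    (fun x _ => plantedLaw_nonneg P w) (mem_univ x)

/-- The mean, over inputs and transcript, of a sum of scores of the elements held by the players
is a combination of mean scores under singly planted laws. -/
theorem sum_tsum_score (hk0 : 0 < k) (hk : k ≤ Fintype.card U) (x₀ : U)
    (φ : Fin t → U → (Fin t → List Bool) → ℝ) {C : ℝ} (hφ : ∀ i x w, |φ i x w| ≤ C) :
    (∑ S ∈ plantedSets t k x₀ ∅, ∑' w, (P.transcript S w).toReal * ∑ i, ∑ x ∈ S i, φ i x w)
        / #(plantedSets t k x₀ ∅)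
      = k / Fintype.card U * ∑ x, ∑ i, ∑' w, plantedLaw P k x {i} w * φ i x w := by
  have hs : ∀ S i x, Summable fun w => (P.transcript S w).toReal * φ i x w := fun S i x => by
    refine Summable.of_norm_bounded ((hasSum_toReal (P.transcript S)).summable.mul_right C)
      fun w => ?_
    rw [Real.norm_eq_abs, abs_mul, abs_of_nonneg ENNReal.toReal_nonneg]
    exact mul_le_mul_of_nonneg_left (hφ i x w) ENNReal.toReal_nonneg
  set G : Fin t → U → (Fin t → Finset U) → ℝ := fun i x S =>
    ∑' w, (P.transcript S w).toReal * φ i x w with hG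
  have h1 : ∀ S, ∑' w, (P.transcript S w).toReal * ∑ i, ∑ x ∈ S i, φ i x w
      = ∑ i, ∑ x ∈ S i, G i x S := fun S => by
    have e : (fun w => (P.transcript S w).toReal * ∑ i, ∑ x ∈ S i, φ i x w)
        = fun w => ∑ i, ∑ x ∈ S i, (P.transcript S w).toReal * φ i x w := by
      funext w
      simp only [mul_sum]
    rw [e]
    exact (hasSum_sum fun i _ => hasSum_sum fun x _ => (hs S i x).hasSum).tsum_eq
  have h2 : ∀ i x, ∑' w, plantedLaw P k x {i} w * φ i x w
      = (∑ S ∈ plantedSets t k x {i}, G i x S) / #(plantedSets t k x {i}) := fun i x =>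
    (hasSum_plantedLaw_mul P fun S => (hs S i x).hasSum).tsum_eq
  have hc : ∀ i (x : U), (#(plantedSets t k x {i}) : ℝ) * Fintype.card U
      = k * #(plantedSets t k x₀ ∅) := fun i x => by
    rw [plantedSets_empty k x₀, ← plantedSets_empty k x]
    exact_mod_cast card_plantedSets_singleton k x i
  have h0' : (0 : ℝ) < #(plantedSets t k x₀ ∅) := by
    exact_mod_cast card_plantedSets_pos hk0 hk x₀ (∅ : Finset (Fin t))
  have hk' : (0 : ℝ) < k := by exact_mod_cast hk0
  have hN : (0 : ℝ) < Fintype.card U := by exact_mod_cast hk0.trans_le hk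
  have h3 : ∀ i x, k / Fintype.card U * ∑' w, plantedLaw P k x {i} w * φ i x w
      = (∑ S ∈ plantedSets t k x {i}, G i x S) / #(plantedSets t k x₀ ∅) := fun i x => by
    have hp : (0 : ℝ) < #(plantedSets t k x {i}) := by
      exact_mod_cast card_plantedSets_pos hk0 hk x {i}
    rw [h2, div_mul_div_comm, div_eq_div_iff (mul_pos hN hp).ne' h0'.ne']
    linear_combination (-∑ S ∈ plantedSets t k x {i}, G i x S) * hc i x
  have h4 : k / Fintype.card U * ∑ x, ∑ i, ∑' w, plantedLaw P k x {i} w * φ i x w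
      = ∑ x, ∑ i, (∑ S ∈ plantedSets t k x {i}, G i x S) / #(plantedSets t k x₀ ∅) := by
    rw [mul_sum]
    refine sum_congr rfl fun x _ => ?_
    rw [mul_sum]
    exact sum_congr rfl fun i _ => h3 i x
  rw [sum_congr rfl fun S _ => h1 S, h4]
  rw [sum_comm (s := (univ : Finset U)), sum_comm (s := plantedSets t k x₀ ∅), sum_div]
  refine sum_congr rfl fun i _ => ?_
  rw [← sum_div, sum_plantedSets_singleton x₀ i]

end Planted

/-! ### The verdict -/

section Verdict

variable {t : ℕ} {U : Type*}

theorem hasSum_toReal_verdict (P : OneWayProtocol t U) (S : Fin t → Finset U) (x : U) (b : Bool) :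
    HasSum (fun w => (P.transcript S w).toReal * (P.referee (lastMessage w) x b).toReal)
      (P.verdict S x b).toReal := by
  have h : P.verdict S x b = ∑' w, P.transcript S w * P.referee (lastMessage w) x b :=
    PMF.bind_apply _ _ _
  have h1 : ∑' w, P.transcript S w * P.referee (lastMessage w) x b ≠ ∞ :=
    h ▸ PMF.apply_ne_top _ _
  rw [h, ENNReal.tsum_toReal_eq fun w => ENNReal.ne_top_of_tsum_ne_top h1 w]
  simpa only [ENNReal.toReal_mul] using (ENNReal.summable_toReal h1).hasSum

theorem toReal_verdict_true_add_false (P : OneWayProtocol t U) (S : Fin t → Finset U) (x : U) :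
    (P.verdict S x true).toReal + (P.verdict S x false).toReal = 1 := by
  have := (hasSum_toReal (P.verdict S x)).tsum_eq
  rwa [tsum_bool, add_comm] at this

end Verdict

/-! ### The exponential moment -/

/-- If `p x / q` has mean `1` over `x`, then its root has mean at most `1`, by `√r ≤ (1 + r) / 2`. If
`q = 0`, the ratios are `0` by convention and the bound still holds. -/
theorem sum_tilt_le {U : Type*} [Fintype U] {p : U → ℝ} {q : ℝ} (hp : ∀ x, 0 ≤ p x) (hq : 0 ≤ q)
    (h : ∑ x, p x = Fintype.card U * q) :
    ∑ x, (1 + √(p x / q)) / 2 ≤ Fintype.card U := by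
  have h1 : ∑ x, p x / q ≤ Fintype.card U := by
    rw [← sum_div, h]
    exact div_le_of_le_mul₀ hq (Nat.cast_nonneg _) le_rfl
  have h2 : ∀ x ∈ (univ : Finset U), (1 + √(p x / q)) / 2 ≤ 3 / 4 + p x / q / 4 := fun x _ => by
    have := Real.sq_sqrt (div_nonneg (hp x) hq)
    nlinarith [sq_nonneg (√(p x / q) - 1)]
  refine (sum_le_sum h2).trans ?_
  rw [sum_add_distrib, sum_const, card_univ, nsmul_eq_mul, ← sum_div]
  linarith

section Bounds

variable {t : ℕ} {U : Type*} [Fintype U] [DecidableEq U] {k : ℕ}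

theorem sum_inputLaw_mul (hk : k ≤ Fintype.card U) (x : U)
    (h : (Fin t → Finset U) → ℝ) :
    ∑ S, (inputLaw t hk S).toReal * h S
      = (∑ S ∈ plantedSets t k x ∅, h S) / #(plantedSets t k x ∅) := by
  rw [plantedSets_empty, sum_div, ← sum_subset (subset_univ _) fun S _ hS => ?_]
  · refine sum_congr rfl fun S hS => ?_
    rw [inputLaw, PMF.uniformOfFinset_apply, if_pos hS, ENNReal.toReal_inv, ENNReal.toReal_natCast,
      div_eq_inv_mul]
  · rw [inputLaw, PMF.uniformOfFinset_apply, if_neg hS, ENNReal.toReal_zero, zero_mul]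

theorem sum_prod_powersetCard_le {F : U → ℝ} (hF : ∀ x, 0 ≤ F x)
    (hsum : ∑ x, F x ≤ Fintype.card U) :
    ∑ S ∈ (univ : Finset U).powersetCard k, ∏ x ∈ S, F x
      ≤ (Fintype.card U : ℝ) ^ k / k.factorial := by
  rw [le_div_iff₀' (by positivity)]
  exact (factorial_mul_esymm_le k univ hF).trans
    (pow_le_pow_left₀ (sum_nonneg fun x _ => hF x) hsum k)

/-- Sampling without replacement inflates the exponential moment over that of independent samples
by at most the inverse of the probability that `k` independent samples are distinct. -/
theorem pow_div_descFactorial_pow_le {N : ℕ} (hk0 : 0 < k) (hk : k ≤ N)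
    (hy : (k : ℝ) ^ 2 * t / N ≤ 1 / 2) :
    ((N : ℝ) ^ k / N.descFactorial k) ^ t ≤ 1 + 2 * ((k : ℝ) ^ 2 * t / N) := by
  have hN : (0 : ℝ) < N := by exact_mod_cast hk0.trans_le hk
  set y := (k : ℝ) ^ 2 * t / N with hydef
  have hy0 : 0 ≤ y := by positivity
  have hd : (0 : ℝ) < N.descFactorial k := by exact_mod_cast Nat.descFactorial_pos.mpr hk
  have h1 : ((N : ℝ) - k) ^ k ≤ N.descFactorial k := by
    have := Nat.pow_sub_le_descFactorial N k
    have h2 : ((N - k : ℕ) : ℝ) ^ k ≤ ((N + 1 - k : ℕ) : ℝ) ^ k :=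
      pow_le_pow_left₀ (Nat.cast_nonneg _) (by exact_mod_cast (by omega)) k
    rw [Nat.cast_sub hk] at h2
    exact h2.trans (by exact_mod_cast this)
  have hkN : (k : ℝ) / N ≤ 1 := (div_le_one hN).mpr (by exact_mod_cast hk)
  have h3 : 1 - y ≤ (((N : ℝ) - k) / N) ^ (k * t) := by
    have := one_add_mul_le_pow (a := -((k : ℝ) / N)) (by linarith) (k * t)
    have e1 : 1 + ((k * t : ℕ) : ℝ) * -((k : ℝ) / N) = 1 - y := by
      rw [hydef]; push_cast; ring
    have e2 : 1 + -((k : ℝ) / N) = ((N : ℝ) - k) / N := by field_simp; ring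
    rwa [e1, e2] at this
  have h4 : (((N : ℝ) - k) / N) ^ (k * t) ≤ ((N.descFactorial k : ℝ) / (N : ℝ) ^ k) ^ t := by
    rw [pow_mul, div_pow]
    refine pow_le_pow_left₀ ?_ (div_le_div_of_nonneg_right h1 (by positivity)) t
    have : (0 : ℝ) ≤ (N : ℝ) - k := by rw [sub_nonneg]; exact_mod_cast hk
    positivity
  have h5 : ((N : ℝ) ^ k / N.descFactorial k) ^ t
      = (((N.descFactorial k : ℝ) / (N : ℝ) ^ k) ^ t)⁻¹ := by
    rw [← inv_pow, inv_div]
  rw [h5]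
  refine inv_le_of_inv_le₀ (by positivity) (le_trans ?_ (h3.trans h4))
  rw [inv_le_iff_one_le_mul₀ (by positivity)]
  nlinarith

theorem sum_inputLaw_exp_le (hk0 : 0 < k) (hk : k ≤ Fintype.card U)
    (hy : (k : ℝ) ^ 2 * t / Fintype.card U ≤ 1 / 2) {F : Fin t → U → ℝ}
    (hF : ∀ i x, 0 < F i x) (hsum : ∀ i, ∑ x, F i x ≤ Fintype.card U) :
    ∑ S : Fin t → Finset U, (inputLaw t hk S).toReal * Real.exp (∑ i, ∑ x ∈ S i, Real.log (F i x))
      ≤ 1 + 2 * ((k : ℝ) ^ 2 * t / Fintype.card U) := by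
  obtain ⟨x₀⟩ : Nonempty U := Fintype.card_pos_iff.mp (hk0.trans_le hk)
  refine le_trans ?_ (pow_div_descFactorial_pow_le hk0 hk hy)
  have hexp : ∀ S : Fin t → Finset U,
      Real.exp (∑ i, ∑ x ∈ S i, Real.log (F i x)) = ∏ i, ∏ x ∈ S i, F i x := fun S => by
    simp only [Real.exp_sum, Real.exp_log (hF _ _)]
  have hd : (0 : ℝ) < (Fintype.card U).choose k := by exact_mod_cast Nat.choose_pos hk
  simp only [hexp]
  rw [sum_inputLaw_mul hk x₀, plantedSets_empty, Fintype.card_piFinset, prod_const,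
    ← prod_univ_sum (fun _ => univ.powersetCard k) fun i S => ∏ x ∈ S, F i x,
    card_powersetCard, card_univ, card_univ, Fintype.card_fin]
  push_cast
  rw [div_le_iff₀ (by positivity), ← mul_pow]
  have e : (Fintype.card U : ℝ) ^ k / (Fintype.card U).descFactorial k
      * (Fintype.card U).choose k = (Fintype.card U : ℝ) ^ k / k.factorial := by
    have := Nat.descFactorial_eq_factorial_mul_choose (Fintype.card U) k
    rw [this]
    push_cast
    field_simp
  rw [e]
  have := prod_le_prod (s := (univ : Finset (Fin t)))
    (fun i _ => sum_nonneg fun S _ => prod_nonneg fun x _ => (hF i x).le)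
    fun i _ => sum_prod_powersetCard_le (k := k) (fun x => (hF i x).le) (hsum i)
  rwa [prod_const, card_univ, Fintype.card_fin] at this

/-! ### The mutual information dominates Hellinger distances -/

/-- The error term `2 k² t / |U|` is the price of sampling without replacement. -/
theorem sum_hellingerSq_le_mutualInfo (P : OneWayProtocol t U) (hk0 : 0 < k)
    (hk : k ≤ Fintype.card U) (hy : (k : ℝ) ^ 2 * t / Fintype.card U ≤ 1 / 2) :
    ENNReal.ofReal (k / Fintype.card U *
        ∑ x, ∑ i, hellingerSq (plantedLaw P k x ∅) (plantedLaw P k x {i}) / 4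
          - 2 * ((k : ℝ) ^ 2 * t / Fintype.card U))
      ≤ mutualInfo (P.jointLaw (inputLaw t hk)) := by
  obtain ⟨x₀⟩ : Nonempty U := Fintype.card_pos_iff.mp (hk0.trans_le hk)
  set N := Fintype.card U with hN
  have hN1 : (1 : ℝ) ≤ N := by exact_mod_cast hk0.trans_le hk
  set φ : Fin t → U → (Fin t → List Bool) → ℝ := fun i x w =>
    logTilt (plantedLaw P k x {i} w) (plantedLaw P k x₀ ∅ w) with hφ
  have hle : ∀ i x w, plantedLaw P k x {i} w ≤ N * plantedLaw P k x₀ ∅ w := fun i x w => by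
    rw [plantedLaw_empty_congr P x₀ x]
    exact plantedLaw_singleton_le P hk0 hk i w
  have hbound : ∀ i x w, |φ i x w| ≤ Real.log 2 + N := fun i x w =>
    abs_logTilt_le hN1 (div_le_of_le_mul₀ (plantedLaw_nonneg P w) (by positivity) (hle i x w))
  have hC : ∀ (S : Fin t → Finset U) w, |∑ i, ∑ x ∈ S i, φ i x w|
      ≤ ∑ _i : Fin t, ∑ _x : U, (Real.log 2 + N) := fun S w => by
    refine (abs_sum_le_sum_abs _ _).trans (sum_le_sum fun i _ => ?_)
    refine (abs_sum_le_sum_abs _ _).trans ?_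
    refine (sum_le_sum fun x _ => hbound i x w).trans ?_
    refine sum_le_sum_of_subset_of_nonneg (subset_univ _) fun x _ _ => ?_
    have := Real.log_pos one_lt_two
    positivity
  have key := le_mutualInfo (inputLaw t hk) P.transcript
    (fun S w => ∑ i, ∑ x ∈ S i, φ i x w) hC (K := 1 + 2 * ((k : ℝ) ^ 2 * t / N)) fun w =>
      sum_inputLaw_exp_le hk0 hk hy
        (fun i x => lt_of_lt_of_le (by norm_num) (half_le_tilt _ _))
        fun i => sum_tilt_le (fun x => plantedLaw_nonneg P w) (plantedLaw_nonneg P w)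
          (sum_plantedLaw_singleton P hk0 hk x₀ i w)
  refine le_trans (ENNReal.ofReal_le_ofReal ?_) key
  rw [sum_inputLaw_mul hk x₀, sum_tsum_score P hk0 hk x₀ φ hbound]
  have h1 : ∀ x i, hellingerSq (plantedLaw P k x ∅) (plantedLaw P k x {i}) / 4
      ≤ ∑' w, plantedLaw P k x {i} w * φ i x w := fun x i => by
    rw [hellingerSq_comm, plantedLaw_empty_congr P x x₀]
    exact hellingerSq_div_four_le_tsum_logTilt (fun w => plantedLaw_nonneg P w)
      (fun w => plantedLaw_nonneg P w) (hasSum_plantedLaw P hk0 hk) (hasSum_plantedLaw P hk0 hk)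
      (hle i x)
  have h2 := mul_le_mul_of_nonneg_left
    (sum_le_sum fun x (_ : x ∈ univ) => sum_le_sum fun i (_ : i ∈ univ) => h1 x i)
    (by positivity : (0 : ℝ) ≤ k / N)
  linarith

/-! ### Correctness separates the planted laws -/

/-- If `R ≥ a` on all but a fraction `ε` of a finite set and `R ≥ 0` throughout, where `a ≤ 1`,
then the mean of `R` is at least `a - ε`. -/
theorem sub_le_sum_div_card {Ω : Type*} (s : Finset Ω) (hs : 0 < #s) (bad : Ω → Prop)
    [DecidablePred bad] (R : Ω → ℝ) {a ε : ℝ} (ha : a ≤ 1) (h0 : ∀ ω, 0 ≤ R ω)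
    (h : ∀ ω ∈ s, ¬ bad ω → a ≤ R ω) (hε : #(s.filter bad) ≤ ε * #s) :
    a - ε ≤ (∑ ω ∈ s, R ω) / #s := by
  rw [le_div_iff₀ (by exact_mod_cast hs)]
  have h1 : ∑ ω ∈ s, (a - if bad ω then 1 else 0) ≤ ∑ ω ∈ s, R ω := by
    refine sum_le_sum fun ω hω => ?_
    split_ifs with hb
    · linarith [h0 ω]
    · simpa using h ω hω hb
  rw [sum_sub_distrib, sum_const, nsmul_eq_mul, sum_boole] at h1
  linarith

/-- The referee's verdict on `x` is a test that separates the unplanted from the fully planted law: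
both kinds of inputs satisfy the promise except with probability `ε`. -/
theorem le_hellingerSq_of_solves (P : OneWayProtocol t U) (ht : 2 ≤ t) (hk0 : 0 < k)
    (hk : k ≤ Fintype.card U) (hP : P.SolvesEDISJ k) {ε : ℝ}
    (hε : (t : ℝ) ^ 2 * k ^ 2 / Fintype.card U ≤ ε) (hε6 : ε < 1 / 6) (x : U) :
    (1 / 3 - 2 * ε) ^ 2 / 4 ≤ hellingerSq (plantedLaw P k x ∅) (plantedLaw P k x univ) := by
  have hN : (0 : ℝ) < Fintype.card U := by exact_mod_cast hk0.trans_le hk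
  have htwo : (2 / 3 : ℝ≥0∞).toReal = 2 / 3 := by simp
  have hsum := fun A => hasSum_plantedLaw P (x := x) (A := A) hk0 hk
  have hr := fun b A => hasSum_plantedLaw_mul (k := k) (x := x) (A := A) P
    fun S => hasSum_toReal_verdict P S x b
  have htest : ∀ (w : Fin t → List Bool) b, (P.referee (lastMessage w) x b).toReal ≤ 1 := fun w b =>
    ENNReal.toReal_le_of_le_ofReal zero_le_one (by simpa using PMF.coe_le_one _ _)
  have hfrac : ∀ (V : Finset U) (𝓕 : Finset (Finset U)),
      (∀ z ∈ V, #{S ∈ 𝓕 | z ∈ S} * Fintype.card U ≤ k * #𝓕) →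
      (#{S ∈ Fintype.piFinset fun _ : Fin t => 𝓕 |
        ∃ i j, i ≠ j ∧ ∃ z ∈ V, z ∈ S i ∧ z ∈ S j} : ℝ)
        ≤ ε * #(Fintype.piFinset fun _ : Fin t => 𝓕) := fun V 𝓕 h => by
    refine le_trans ?_ (mul_le_mul_of_nonneg_right hε (Nat.cast_nonneg _))
    rw [div_mul_eq_mul_div, le_div_iff₀ hN]
    exact_mod_cast card_filter_meet_mul_card_le 𝓕 V k h
  have hno : 2 / 3 - ε ≤ (∑ S ∈ plantedSets t k x ∅, (P.verdict S x false).toReal)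
      / #(plantedSets t k x ∅) := by
    refine sub_le_sum_div_card _ (card_plantedSets_pos hk0 hk x _)
      (fun S => ∃ i j, i ≠ j ∧ ∃ z ∈ univ, z ∈ S i ∧ z ∈ S j) _ (by norm_num)
      (fun _ => ENNReal.toReal_nonneg) (fun S hS hgood => ?_) ?_
    · have hdisj : ∀ i j, i ≠ j → Disjoint (S i) (S j) := fun i j hij =>
        disjoint_left.mpr fun z hz hz' => hgood ⟨i, j, hij, z, mem_univ z, hz, hz'⟩
      have hnot : ¬ IsUniqueCommon S x := fun h => by
        have hx := (h x).mpr rfl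
        exact disjoint_left.mp (hdisj ⟨0, by omega⟩ ⟨1, by omega⟩ (by simp)) (hx _) (hx _)
      have := (hP S x (.inl hdisj) fun i => ((mem_plantedSets.mp hS).1 i).le).2 hnot
      rw [← htwo]
      exact ENNReal.toReal_mono (PMF.apply_ne_top _ _) this
    · rw [plantedSets_empty]
      convert hfrac univ (univ.powersetCard k) fun z hz => ?_
      have := card_filter_mem_mul_card (k := k) hz
      rw [card_univ] at this
      exact this.le
  have hyes : 2 / 3 - ε ≤ (∑ S ∈ plantedSets t k x univ, (P.verdict S x true).toReal)
      / #(plantedSets t k x univ) := by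
    refine sub_le_sum_div_card _ (card_plantedSets_pos hk0 hk x _)
      (fun S => ∃ i j, i ≠ j ∧ ∃ z ∈ univ.erase x, z ∈ S i ∧ z ∈ S j) _ (by norm_num)
      (fun _ => ENNReal.toReal_nonneg) (fun S hS hgood => ?_) ?_
    · obtain ⟨hcard, hx⟩ := mem_plantedSets.mp hS
      have hx' : ∀ i, x ∈ S i := fun i => hx i (mem_univ i)
      have huniq : ∀ i j, i ≠ j → ∀ z, z ∈ S i → z ∈ S j → z = x := fun i j hij z hz hz' => by
        by_contra hne
        exact hgood ⟨i, j, hij, z, by simp [hne], hz, hz'⟩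
      have hcommon : IsUniqueCommon S x := fun y =>
        ⟨fun h => huniq ⟨0, by omega⟩ ⟨1, by omega⟩ (by simp) y (h _) (h _), fun h => h ▸ hx'⟩
      have := (hP S x (.inr ⟨x, hx', huniq⟩) fun i => (hcard i).le).1 hcommon
      rw [← htwo]
      exact ENNReal.toReal_mono (PMF.apply_ne_top _ _) this
    · rw [plantedSets_univ]
      convert hfrac (univ.erase x) {S ∈ univ.powersetCard k | x ∈ S} fun z hz =>
        card_filter_mem_filter_mul_card_le hk (ne_of_mem_erase hz)
  have hyes' : (∑ S ∈ plantedSets t k x ∅, (P.verdict S x true).toReal)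
      / #(plantedSets t k x ∅) = 1 - (∑ S ∈ plantedSets t k x ∅, (P.verdict S x false).toReal)
      / #(plantedSets t k x ∅) := by
    have h0 : (#(plantedSets t k x ∅) : ℝ) ≠ 0 := by
      exact_mod_cast (card_plantedSets_pos hk0 hk x (∅ : Finset (Fin t))).ne'
    rw [eq_sub_iff_add_eq, ← add_div, ← sum_add_distrib,
      sum_congr rfl fun S _ => toReal_verdict_true_add_false P S x]
    simp [h0]
  rw [hellingerSq_comm]
  refine sq_div_four_le_hellingerSq (fun w => plantedLaw_nonneg P w)
    (fun w => plantedLaw_nonneg P w) (hsum _) (hsum _) (fun w => ENNReal.toReal_nonneg)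
    (fun w => htest w true) (hr true univ) (hr true ∅) (by linarith) ?_
  rw [hyes']
  linarith

end Bounds

/-! ### The parameters -/

theorem twentyThree_le_of_lt_div_log {t m : ℕ} (ht : 2 ≤ t) (hm : 2 ≤ m)
    (h : (t : ℝ) < m / (4 * Real.log m)) : 23 ≤ m := by
  have hm' : (1 : ℝ) < m := by exact_mod_cast hm
  have hlog : 0 < Real.log m := Real.log_pos hm'
  have ht' : (2 : ℝ) ≤ t := by exact_mod_cast ht
  rw [lt_div_iff₀ (by positivity)] at h
  have h8 : 8 * Real.log m < m := by nlinarith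
  have h2 := Real.log_two_gt_d9
  -- `log m ≥ j log 2` for `m ≥ 2 ^ j`, and `8 log m < m` then rules out the range
  -- of `m` up to `8 j log 2`. These ranges for `j = 1, 2, 3, 4` cover all `m ≤ 22`.
  have hpow : ∀ j : ℕ, 2 ^ j ≤ m → 8 * (j * 0.6931471803) < (m : ℝ) := fun j hj => by
    have h3 : Real.log ((2 : ℝ) ^ j) ≤ Real.log m :=
      Real.log_le_log (by positivity) (by exact_mod_cast hj)
    rw [Real.log_pow] at h3
    have : (j : ℝ) * 0.6931471803 ≤ j * Real.log 2 :=
      mul_le_mul_of_nonneg_left h2.le (Nat.cast_nonneg j)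
    linarith
  by_contra! hlt
  have hup : ∀ n : ℕ, m ≤ n → (m : ℝ) ≤ n := fun n hn => by exact_mod_cast hn
  rcases le_or_gt m 5 with h5 | h5
  · have hlo := hpow 1 (by omega)
    have hhi := hup 5 h5
    push_cast at hlo hhi
    linarith
  rcases le_or_gt m 11 with h11 | h11
  · have hlo := hpow 2 (by omega)
    have hhi := hup 11 h11
    push_cast at hlo hhi
    linarith
  rcases le_or_gt m 16 with h16 | h16
  · have hlo := hpow 3 (by omega)
    have hhi := hup 16 h16
    push_cast at hlo hhi
    linarith
  · have hlo := hpow 4 (by omega)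
    have hhi := hup 22 (by omega)
    push_cast at hlo hhi
    linarith

end ExamDisjointness

theorem theorem4p1 :
    ∃ c : ℝ, 0 < c ∧
      ∀ (t m : ℕ) (U : Type*) [Fintype U] (hU : m ^ 4 ≤ Fintype.card U),
        2 ≤ t → 2 ≤ m → (t : ℝ) < m / (4 * Real.log m) →
        ∀ P : ExamDisjointness.OneWayProtocol t U,
          P.SolvesEDISJ (ExamDisjointness.setSize m t) →
          ENNReal.ofReal (c * (m / t)) ≤
            ExamDisjointness.mutualInfo
              (P.jointLaw
                (ExamDisjointness.inputLaw t (ExamDisjointness.setSize_le_card t hU))) := by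
  classical
  refine ⟨1 / 10000, by norm_num, ?_⟩
  intro t m U _ hU ht hm htm P hP
  have hm23 := ExamDisjointness.twentyThree_le_of_lt_div_log ht hm htm
  have hm23' : (23 : ℝ) ≤ m := by exact_mod_cast hm23
  have ht2 : (2 : ℝ) ≤ t := by exact_mod_cast ht
  have htm' : (t : ℝ) ≤ m := by
    refine htm.le.trans (div_le_self (by positivity) ?_)
    have h1 := Real.log_two_gt_d9
    have h2 := Real.log_le_log (by norm_num) (show (2 : ℝ) ≤ m by linarith)
    linarith
  set k := ExamDisjointness.setSize m t with hkdef
  have hk := ExamDisjointness.setSize_le_card t hU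
  have hkge : (m : ℝ) / t ≤ k := Nat.le_ceil _
  have hkpos : (0 : ℝ) < k := lt_of_lt_of_le (by positivity) hkge
  have hk0 : 0 < k := by exact_mod_cast hkpos
  have hkt : (k : ℝ) * t ≤ 2 * m := by
    have h1 : (k : ℝ) < m / t + 1 := Nat.ceil_lt_add_one (by positivity)
    have h2 : (k : ℝ) * t ≤ (m / t + 1) * t :=
      mul_le_mul_of_nonneg_right h1.le (by positivity)
    have h3 : ((m : ℝ) / t + 1) * t = m + t := by field_simp
    linarith
  have hN4 : (m : ℝ) ^ 4 ≤ Fintype.card U := by exact_mod_cast hU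
  have hNpos : (0 : ℝ) < Fintype.card U := lt_of_lt_of_le (by positivity) hN4
  -- The probability `ε` that two random sets meet away from the planted point.
  have hε : (t : ℝ) ^ 2 * k ^ 2 / Fintype.card U ≤ 1 / 100 := by
    rw [div_le_iff₀ hNpos]
    have h1 : ((k : ℝ) * t) ^ 2 ≤ (2 * m) ^ 2 := pow_le_pow_left₀ (by positivity) hkt 2
    have h2 : (23 : ℝ) ^ 2 ≤ (m : ℝ) ^ 2 := pow_le_pow_left₀ (by norm_num) hm23' 2
    nlinarith [sq_nonneg (m : ℝ)]
  have hy : (k : ℝ) ^ 2 * t / Fintype.card U ≤ k * (1 / 6000) := by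
    rw [div_le_iff₀ hNpos]
    have h2 : (23 : ℝ) ^ 3 ≤ (m : ℝ) ^ 3 := pow_le_pow_left₀ (by norm_num) hm23' 3
    have h3 : (k : ℝ) * t ≤ 1 / 6000 * Fintype.card U := by nlinarith
    nlinarith
  have hy2 : (k : ℝ) ^ 2 * t / Fintype.card U ≤ 1 / 2 := by
    refine le_trans (div_le_div_of_nonneg_right ?_ hNpos.le) (hε.trans (by norm_num))
    have : (t : ℝ) ≤ t ^ 2 := by nlinarith
    nlinarith [mul_pos hkpos hkpos]
  have : Nonempty (Fin t) := ⟨⟨0, by omega⟩⟩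
  -- The total variation gap `1/3 - 2/100` and the factor `e² ≤ 8` leave at least `1/1600`.
  have hexp : Real.exp 2 ≤ 8 := by
    have h1 := Real.exp_one_lt_d9
    have h2 : Real.exp 2 = Real.exp 1 * Real.exp 1 := by rw [← Real.exp_add]; norm_num
    nlinarith [Real.exp_pos 1]
  have hH : ∀ x : U, (1 : ℝ) / 1600 ≤ ∑ i, ExamDisjointness.hellingerSq
      (ExamDisjointness.plantedLaw P k x ∅) (ExamDisjointness.plantedLaw P k x {i}) / 4 := by
    intro x
    have h1 := ExamDisjointness.le_hellingerSq_of_solves P ht hk0 hk hP hε (by norm_num) x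
    have h2 := ExamDisjointness.hellingerSq_univ_le (ExamDisjointness.plantedLaw P k x)
      (fun A w => ExamDisjointness.plantedLaw_nonneg P w)
      (fun A => ExamDisjointness.hasSum_plantedLaw P hk0 hk)
      (fun A B hAB w => ExamDisjointness.plantedLaw_mul_plantedLaw P hAB w)
    have h3 : 0 ≤ ∑ i, ExamDisjointness.hellingerSq
        (ExamDisjointness.plantedLaw P k x ∅) (ExamDisjointness.plantedLaw P k x {i}) :=
      Finset.sum_nonneg fun i _ => ExamDisjointness.hellingerSq_nonneg
    rw [← Finset.sum_div]
    nlinarith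
  refine le_trans (ENNReal.ofReal_le_ofReal ?_)
    (ExamDisjointness.sum_hellingerSq_le_mutualInfo P hk0 hk hy2)
  have h4 := Finset.sum_le_sum fun x (_ : x ∈ (Finset.univ : Finset U)) => hH x
  rw [Finset.sum_const, Finset.card_univ, nsmul_eq_mul] at h4
  have h5 := mul_le_mul_of_nonneg_left h4 (by positivity : (0 : ℝ) ≤ k / Fintype.card U)
  have h6 : (k : ℝ) / Fintype.card U * (Fintype.card U * (1 / 1600)) = k * (1 / 1600) := by
    field_simp
  rw [h6] at h5
  linarith
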